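/- Let $\mathcal K$ be a number field with ring of integers $\mathcal O$, let $\mathbb A(\mathcal K)$ be its ring of full adeles, and for a place $v$ of $\mathcal K$ let $\mathcal K_v$ be the completion of $\mathcal K$ at $v$, with ring of integers $\mathcal O_v$ if $v$ is finite. For a prime $p$ let $\chi_p(x)=\exp(2\pi i\lambda_p(x))$ for $x\in\mathbb Q_p$, where $\lambda_p(x)\in\mathbb Z[1/p]$ satisfies $x-\lambda_p(x)\in\mathbb Z_p$, and let $\chi_\infty(x)=\exp(-2\pi i x)$ for $x\in\mathbb Q_\infty=\mathbb R$. Put $\chi_{\mathbb A(\mathbb Q)}(x)=\prod_{p\le\infty}\chi_p(x_p)$ for $x\in\mathbb A(\mathbb Q)$, put $\operatorname{Tr}(a)=\bigl(\sum_{v\mid p}\operatorname{Tr}_{\mathcal K_v/\mathbb Q_p}(a_v)\bigr)_{p\le\infty}\in\mathbb A(\mathbb Q)$ for $a\in\mathbb A(\mathcal K)$, and let $\langle a,b\rangle=\chi_{\mathbb A(\mathbb Q)}(\operatorname{Tr}(ab))$ be the canonical pairing of $\mathbb A(\mathcal K)$ with itself. For a finite place $v\mid p$ let $$\mathfrak D_v^{-1}=\{b\in\mathcal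 K_v : \operatorname{Tr}_{\mathcal K_v/\mathbb Q_p}(ab)\in\mathbb Z_p\text{ for all }a\in\mathcal O_v\}.$$ Then the product $\mathcal D^{-1}=\prod_{v\nmid\infty}\mathfrak D_v^{-1}$, with its product topology, is embedded homeomorphically in $\mathbb A(\mathcal K)$ by attaching zero components at the infinite places; that is, it is identified, as a topological group, with the subgroup $\mathcal D^{-1}\times\prod_{v\mid\infty}\{0\}$ of all adeles $b$ with $b_v\in\mathfrak D_v^{-1}$ for every finite $v$ and $b_v=0$ for every infinite $v$. Moreover, the canonical pairing induces an isomorphism of topological groups of the Pontryagin dual of the discrete group $\mathcal K/\mathcal O$ onto $\mathcal D^{-1}\times\prod_{v\mid\infty}\{0\}$: the character $\chi$ of $\mathcal K/\mathcal O$ corresponds to the unique $b\in\mathcal D^{-1}\times\prod_{v\mid\infty}\{0\}$ with $$\chi(k+\mathcal O)=\langle k,b\rangle\qquad\text{for all }k\in\mathcal K .$$ -/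

import Mathlib

open NumberField IsDedekindDomain

noncomputable section

namespace AdelicDuality

instance factPrimePrimes (p : Nat.Primes) : Fact p.1.Prime := ⟨p.2⟩

/-! ### The standard characters of the completions of `ℚ` -/

theorem exists_padic_principalPart (p : ℕ) [Fact p.Prime] (x : ℚ_[p]) :
    ∃ r : ℚ, (∃ (m : ℤ) (n : ℕ), r = m / (p : ℚ) ^ n) ∧ x - (r : ℚ_[p]) ∈ PadicInt.subring p := by
  have hp : (p : ℚ_[p]) ≠ 0 := by
    exact_mod_cast (Fact.out : p.Prime).ne_zero
  obtain ⟨n, hn⟩ : ∃ n : ℕ, ‖(p : ℚ_[p]) ^ n * x‖ ≤ 1 := by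
    have hlim : Filter.Tendsto (fun n : ℕ => ‖(p : ℚ_[p])‖ ^ n * ‖x‖) Filter.atTop
        (nhds (0 * ‖x‖)) :=
      (tendsto_pow_atTop_nhds_zero_of_lt_one (norm_nonneg _) Padic.norm_p_lt_one).mul_const _
    rw [zero_mul] at hlim
    obtain ⟨n, hn⟩ := (hlim.eventually (ge_mem_nhds zero_lt_one)).exists
    exact ⟨n, by simpa [norm_mul, norm_pow] using hn⟩
  set y : ℤ_[p] := ⟨(p : ℚ_[p]) ^ n * x, hn⟩
  obtain ⟨c, hc⟩ := Ideal.mem_span_singleton.mp (PadicInt.appr_spec n y)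
  refine ⟨(y.appr n : ℤ) / (p : ℚ) ^ n, ⟨_, n, rfl⟩, ?_⟩
  have h1 : (p : ℚ_[p]) ^ n * x - (y.appr n : ℚ_[p]) = (p : ℚ_[p]) ^ n * (c : ℚ_[p]) := by
    have := congrArg (fun z : ℤ_[p] => (z : ℚ_[p])) hc
    simp only [PadicInt.coe_sub, PadicInt.coe_natCast, PadicInt.coe_mul, PadicInt.coe_pow] at this
    exact this
  have h2 : x - (((y.appr n : ℤ) / (p : ℚ) ^ n : ℚ) : ℚ_[p]) = (c : ℚ_[p]) := by
    push_cast
    have hpn : (p : ℚ_[p]) ^ n ≠ 0 := pow_ne_zero _ hp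
    field_simp
    linear_combination h1
  rw [h2]
  exact c.2

/-- A rational number `λ_p(x) ∈ ℤ[1/p]` with `x - λ_p(x) ∈ ℤ_p`; it is unique modulo `ℤ`. -/
def principalPart (p : ℕ) [Fact p.Prime] (x : ℚ_[p]) : ℚ :=
  (exists_padic_principalPart p x).choose

/-- The character `χ_p(x) = exp(2πi λ_p(x))` of `ℚ_p`. -/
def padicChar (p : ℕ) [Fact p.Prime] (x : ℚ_[p]) : Circle :=
  Circle.exp (2 * Real.pi * (principalPart p x : ℝ))

/-- The character `χ_∞(x) = exp(-2πi x)` of `ℝ`. -/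
def realChar (x : ℝ) : Circle :=
  Circle.exp (-(2 * Real.pi * x))

/-- The character `χ_{𝔸(ℚ)}(x) = ∏_p χ_p(x_p)`, the product being over all places of `ℚ`, for
`x = (x_∞, (x_p)_p)`. If `x` is an adele, then `x_p ∈ ℤ_p` for almost all `p`, so that only
finitely many factors differ from `1`. -/
def adelicChar (x : ℝ × (∀ p : Nat.Primes, ℚ_[p.1])) : Circle :=
  realChar x.1 * ∏ᶠ p : Nat.Primes, padicChar p.1 (x.2 p)

/-! ### The local extensions `K_v / ℚ_p` and `K_v / ℝ` and their traces -/

variable {K : Type*} [Field K] [NumberField K]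

/-- The canonical embedding of `ℝ` in the completion of `K` at an infinite place. -/
def realToCompletion (v : InfinitePlace K) : ℝ →+* v.Completion :=
  open Classical in
  if hv : v.IsReal then
    (InfinitePlace.Completion.ringEquivRealOfIsReal hv).symm.toRingHom
  else
    (InfinitePlace.Completion.ringEquivComplexOfIsComplex
      (InfinitePlace.not_isReal_iff_isComplex.1 hv)).symm.toRingHom.comp Complex.ofRealHom

/-- The trace `Tr_{K_v/ℝ}` at an infinite place `v`. -/
def infiniteTrace (v : InfinitePlace K) (x : v.Completion) : ℝ :=
  letI : Algebra ℝ v.Completion := (realToCompletion v).toAlgebra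
  Algebra.trace ℝ v.Completion x

theorem norm_ratCast_le_one (v : HeightOneSpectrum (𝓞 K)) (p : ℕ) [Fact p.Prime]
    (hv : (p : 𝓞 K) ∈ v.asIdeal) (q : ℚ) (hq : ‖(q : ℚ_[p])‖ ≤ 1) :
    ‖FinitePlace.embedding v (q : K)‖ ≤ 1 := by
  have hden : ¬ p ∣ q.den := by
    intro h
    have hnum : ¬ (p : ℤ) ∣ q.num := by
      intro h'
      have := Nat.dvd_gcd (Int.natCast_dvd.mp h') h
      rw [q.reduced] at this
      exact (Fact.out : p.Prime).one_lt.ne' (Nat.dvd_one.mp this)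
    have hn1 : ‖((q.num : ℤ) : ℚ_[p])‖ = 1 := by
      refine le_antisymm (Padic.norm_int_le_one _) (not_lt.mp fun hlt => hnum ?_)
      exact (Padic.norm_intCast_lt_one_iff).mp hlt
    have hd1 : ‖((q.den : ℤ) : ℚ_[p])‖ < 1 :=
      (Padic.norm_intCast_lt_one_iff).mpr (by exact_mod_cast h)
    have hmul : (q : ℚ_[p]) * ((q.den : ℤ) : ℚ_[p]) = ((q.num : ℤ) : ℚ_[p]) := by
      have := Rat.mul_den_eq_num q
      exact_mod_cast congrArg (fun r : ℚ => (r : ℚ_[p])) this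
    have := congrArg norm hmul
    rw [norm_mul, hn1] at this
    nlinarith [norm_nonneg (q : ℚ_[p]), norm_nonneg ((q.den : ℤ) : ℚ_[p])]
  have hden' : ((q.den : ℕ) : 𝓞 K) ∉ v.asIdeal := by
    intro h
    have hco : IsCoprime (p : ℤ) (q.den : ℤ) :=
      Nat.isCoprime_iff_coprime.mpr (((Fact.out : p.Prime).coprime_iff_not_dvd).mpr hden)
    obtain ⟨a, b, hab⟩ := hco
    apply v.isPrime.ne_top
    rw [Ideal.eq_top_iff_one]
    have : (1 : 𝓞 K) = (a : 𝓞 K) * (p : 𝓞 K) + (b : 𝓞 K) * ((q.den : ℕ) : 𝓞 K) := by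
      exact_mod_cast (congrArg (fun z : ℤ => (z : 𝓞 K)) hab).symm
    rw [this]
    exact v.asIdeal.add_mem (v.asIdeal.mul_mem_left _ hv) (v.asIdeal.mul_mem_left _ h)
  have hd : ‖FinitePlace.embedding v (algebraMap (𝓞 K) K ((q.den : ℕ) : 𝓞 K))‖ = 1 :=
    (FinitePlace.norm_eq_one_iff_notMem K v _).mpr hden'
  have hn : ‖FinitePlace.embedding v (algebraMap (𝓞 K) K ((q.num : ℤ) : 𝓞 K))‖ ≤ 1 :=
    FinitePlace.norm_le_one K v _
  have hmul : (q : K) * algebraMap (𝓞 K) K ((q.den : ℕ) : 𝓞 K)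
      = algebraMap (𝓞 K) K ((q.num : ℤ) : 𝓞 K) := by
    have := Rat.mul_den_eq_num q
    simp only [map_natCast, map_intCast]
    exact_mod_cast congrArg (fun r : ℚ => (r : K)) this
  have := congrArg (fun z => ‖FinitePlace.embedding v z‖) hmul
  simp only [map_mul, norm_mul] at this
  rw [hd, mul_one] at this
  rw [this]
  exact hn

/-- The embedding `ℚ → K_v`, where `ℚ` carries the `p`-adic topology. -/
def ratToCompletion (v : HeightOneSpectrum (𝓞 K)) (p : ℕ) [Fact p.Prime] :
    WithVal (Rat.padicValuation p) →+* v.adicCompletion K :=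
  (FinitePlace.embedding v).comp
    ((Rat.castHom K).comp (WithVal.equiv (Rat.padicValuation p)).toRingHom)

theorem continuous_ratToCompletion (v : HeightOneSpectrum (𝓞 K)) (p : ℕ) [Fact p.Prime]
    (hv : (p : 𝓞 K) ∈ v.asIdeal) : Continuous (ratToCompletion v p) := by
  refine continuous_of_continuousAt_zero (ratToCompletion v p) ?_
  rw [ContinuousAt, map_zero, Padic.isUniformInducing_cast_withVal.isInducing.nhds_eq_comap,
    map_zero, Metric.tendsto_nhds]
  intro ε hε
  have hpv : ‖FinitePlace.embedding v (algebraMap (𝓞 K) K (p : 𝓞 K))‖ < 1 :=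
    (FinitePlace.norm_lt_one_iff_mem K v _).mpr hv
  obtain ⟨n, hn⟩ := exists_pow_lt_of_lt_one hε hpv
  have hp0 : (p : ℚ) ≠ 0 := by exact_mod_cast (Fact.out : p.Prime).ne_zero
  have hpn : 0 < ‖(p : ℚ_[p]) ^ n‖ := by
    rw [norm_pos_iff]
    exact pow_ne_zero _ (by exact_mod_cast (Fact.out : p.Prime).ne_zero)
  refine Filter.mem_comap.mpr ⟨Metric.ball 0 ‖(p : ℚ_[p]) ^ n‖, Metric.ball_mem_nhds _ hpn, ?_⟩
  intro x hx
  set q : ℚ := WithVal.equiv (Rat.padicValuation p) x with hqx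
  have hq : ‖(q : ℚ_[p])‖ < ‖(p : ℚ_[p]) ^ n‖ := by
    simpa [hqx] using hx
  have hr : ‖((q / (p : ℚ) ^ n : ℚ) : ℚ_[p])‖ ≤ 1 := by
    push_cast
    rw [norm_div, div_le_one hpn]
    exact hq.le
  have hr' := norm_ratCast_le_one v p hv _ hr
  have hqr : (q : K) = algebraMap (𝓞 K) K (p : 𝓞 K) ^ n * ((q / (p : ℚ) ^ n : ℚ) : K) := by
    have h : q = (p : ℚ) ^ n * (q / (p : ℚ) ^ n) := by field_simp
    rw [map_natCast]
    exact_mod_cast congrArg (fun r : ℚ => (r : K)) h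
  have hval : ratToCompletion v p x = FinitePlace.embedding v (q : K) := rfl
  change dist (ratToCompletion v p x) 0 < ε
  rw [dist_zero_right, hval, hqr, map_mul, map_pow, norm_mul, norm_pow]
  exact (mul_le_of_le_one_right (by positivity) hr').trans_lt hn

/-- The canonical embedding `ℚ_p → K_v` for a finite place `v` above `p`: the extension by
continuity of the embedding `ℚ → K_v`. -/
def padicToCompletion (v : HeightOneSpectrum (𝓞 K)) (p : ℕ) [Fact p.Prime]
    (hv : (p : 𝓞 K) ∈ v.asIdeal) : ℚ_[p] →+* v.adicCompletion K :=
  (UniformSpace.Completion.extensionHom (ratToCompletion v p)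
    (continuous_ratToCompletion v p hv)).comp Padic.withValRingEquiv.symm.toRingHom

/-- The trace `Tr_{K_v/ℚ_p}` at a finite place `v` above `p`. -/
def finiteTrace (v : HeightOneSpectrum (𝓞 K)) (p : ℕ) [Fact p.Prime]
    (hv : (p : 𝓞 K) ∈ v.asIdeal) (x : v.adicCompletion K) : ℚ_[p] :=
  letI : Algebra ℚ_[p] (v.adicCompletion K) := (padicToCompletion v p hv).toAlgebra
  Algebra.trace ℚ_[p] (v.adicCompletion K) x

variable (K) in
/-- The trace `Tr_{𝔸(K)/𝔸(ℚ)}`: its component at a place `p ≤ ∞` of `ℚ` is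
`∑_{v ∣ p} Tr_{K_v/ℚ_p}(a_v)`, where `ℚ_∞ = ℝ`. -/
def adelicTrace (a : AdeleRing (𝓞 K) K) : ℝ × (∀ p : Nat.Primes, ℚ_[p.1]) :=
  (∑ v : InfinitePlace K, infiniteTrace v (a.1 v),
    fun p => ∑ᶠ v : {v : HeightOneSpectrum (𝓞 K) // (p.1 : 𝓞 K) ∈ v.asIdeal},
      finiteTrace v.1 p.1 v.2 (a.2 v.1))

variable (K) in
/-- The canonical pairing `⟨a, b⟩ = χ_{𝔸(ℚ)}(Tr_{𝔸(K)/𝔸(ℚ)}(ab))` of `𝔸(K)` with itself. -/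
def adelicPairing (a b : AdeleRing (𝓞 K) K) : Circle :=
  adelicChar (adelicTrace K (a * b))

/-! ### The inverse different -/

/-- The local inverse different
`𝔇_v⁻¹ = {b ∈ K_v | Tr_{K_v/ℚ_p}(ab) ∈ ℤ_p for all a ∈ 𝓞_v}`, where `p` is the prime below `v`. -/
def localInverseDifferent (v : HeightOneSpectrum (𝓞 K)) : AddSubgroup (v.adicCompletion K) where
  carrier := {b | ∀ (p : Nat.Primes) (hv : (p.1 : 𝓞 K) ∈ v.asIdeal),
    ∀ a ∈ v.adicCompletionIntegers K, finiteTrace v p.1 hv (a * b) ∈ PadicInt.subring p.1}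
  zero_mem' := fun p hv a _ => by simp [finiteTrace]
  add_mem' := fun {b c} hb hc p hv a ha => by
    have := (PadicInt.subring p.1).add_mem (hb p hv a ha) (hc p hv a ha)
    simpa [finiteTrace, mul_add] using this
  neg_mem' := fun {b} hb p hv a ha => by
    have := (PadicInt.subring p.1).neg_mem (hb p hv a ha)
    simpa [finiteTrace] using this

variable (K) in
/-- The adelic inverse different `𝒟⁻¹ × ∏_{v ∣ ∞} {0}`, as a subgroup of the full adeles. -/
def adelicInverseDifferent : AddSubgroup (AdeleRing (𝓞 K) K) where
  carrier := {b | b.1 = 0 ∧ ∀ v : HeightOneSpectrum (𝓞 K), b.2 v ∈ localInverseDifferent v}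
  zero_mem' := ⟨rfl, fun v => (localInverseDifferent v).zero_mem⟩
  add_mem' := fun hb hc =>
    ⟨(congrArg₂ (· + ·) hb.1 hc.1).trans (add_zero 0),
      fun v => (localInverseDifferent v).add_mem (hb.2 v) (hc.2 v)⟩
  neg_mem' := fun hb =>
    ⟨(congrArg (- ·) hb.1).trans neg_zero, fun v => (localInverseDifferent v).neg_mem (hb.2 v)⟩

/-! ### The discrete group `K / 𝓞` -/

variable (K) in
/-- The ring of integers as an additive subgroup of `K`. -/
def integersAddSubgroup : AddSubgroup K := (algebraMap (𝓞 K) K).range.toAddSubgroup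

variable (K) in
/-- The quotient group `K / 𝓞`. -/
def FieldModIntegers : Type _ := K ⧸ integersAddSubgroup K

instance : AddCommGroup (FieldModIntegers K) :=
  inferInstanceAs (AddCommGroup (K ⧸ integersAddSubgroup K))

/-- `K / 𝓞` is a discrete group. -/
instance : TopologicalSpace (FieldModIntegers K) := ⊥

instance : DiscreteTopology (FieldModIntegers K) := ⟨rfl⟩

/-- The class `k + 𝓞`. -/
def toFieldModIntegers (k : K) : FieldModIntegers K :=
  QuotientAddGroup.mk (s := integersAddSubgroup K) k

end AdelicDuality

end

/-!
The group `K / 𝓞` is a discrete torsion group and the adelic inverse different is compact, so by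
finite duality and compactness it is enough to know that the pairing `⟨k, b⟩` is continuous in `b`
and nondegenerate on both sides.

For `k ∈ K` and `b` in the adelic inverse different, `⟨k, b⟩ = ∏_p χ_p(Tr_p(k b_p))`, where `b_p`
is the component of `b` in `∏_{v ∣ p} K_v` and `Tr_p` is the trace of that algebra over `ℚ_p`. An
integral basis `(ω_i)` of `K` is a basis of `∏_{v ∣ p} K_v` over `ℚ_p` and of `∏_{v ∣ p} 𝓞_v` over
`ℤ_p`; hence `b_p = ∑ Tr_p(ω_i b_p) ω_i^*` for the trace-dual basis `(ω_i^*)`, and `b_p` lies in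
the inverse different if and only if these coefficients are in `ℤ_p`. Testing `b` against all
`ω_i / p ^ n`, which only involves the factor at `p`, gives `b_p = 0`. Testing `k` against the
element with component `ω_i^*` at `p` and `0` elsewhere shows that the `i`-th coordinate of `k` is
`p`-integral.
-/

noncomputable section

namespace AdelicDuality

/-! ### Duality between a discrete torsion group and a compact group -/

theorem subgroup_eq_top_of_separatesPoints {G M : Type*} [CommGroup G] [Finite G] [CommMonoid M]
    [HasEnoughRootsOfUnity M (Monoid.exponent G)] {S : Subgroup (G →* Mˣ)}
    (hS : ∀ g : G, (∀ φ ∈ S, φ g = 1) → g = 1) : S = ⊤ := by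
  let e := CommGroup.subgroupOrderIsoSubgroupMonoidHom G M
  have he : e.symm (OrderDual.toDual S) = ⊥ := by
    rw [eq_bot_iff]
    exact fun g hg =>
      hS g ((CommGroup.mem_subgroupOrderIsoSubgroupMonoidHom_symm_iff M S g).1 hg)
  rw [OrderIso.symm_apply_eq, map_bot] at he
  exact congrArg OrderDual.ofDual he

section Pontryagin

variable {A H : Type*} [CommGroup A] [TopologicalSpace A] [Group H]
  {f : H →* PontryaginDual A}

theorem exists_eqOn_of_separatesPoints (hf : ∀ a, (∀ h, f h a = 1) → a = 1) (B : Subgroup A)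
    [Finite B] (χ : PontryaginDual A) : ∃ h, ∀ b ∈ B, f h b = χ b := by
  let restrict : PontryaginDual A →* (B →* Circleˣ) :=
    { toFun := fun ψ => toUnits.toMonoidHom.comp ((ψ : A →* Circle).comp B.subtype)
      map_one' := MonoidHom.ext fun _ => Units.ext rfl
      map_mul' := fun _ _ => MonoidHom.ext fun _ => Units.ext rfl }
  have htop : (restrict.comp f).range = ⊤ := by
    refine subgroup_eq_top_of_separatesPoints (M := Circle) fun b hb => Subtype.ext (hf b ?_)
    exact fun h => congrArg Units.val (hb _ ⟨h, rfl⟩)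
  obtain ⟨h, hh⟩ := htop.ge (Subgroup.mem_top (restrict χ))
  refine ⟨h, fun b hb => ?_⟩
  exact congrArg (fun φ : B →* Circleˣ => (φ ⟨b, hb⟩ : Circle)) hh

variable [TopologicalSpace H]

theorem surjective_of_separatesPoints [CompactSpace H] (hA : IsMulTorsion A)
    (hcont : ∀ a, Continuous fun h => f h a) (hf : ∀ a, (∀ h, f h a = 1) → a = 1) :
    Function.Surjective f := by
  intro χ
  suffices (⋂ a, {h | f h a = χ a}).Nonempty by
    obtain ⟨h, hh⟩ := this
    exact ⟨h, PontryaginDual.ext fun a => Set.mem_iInter.1 hh a⟩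
  refine CompactSpace.iInter_nonempty (fun a => isClosed_eq (hcont a) continuous_const) fun s => ?_
  let B := Subgroup.closure (s : Set A)
  have : Finite B := CommGroup.finite_of_fg_isMulTorsion B (hA.subgroup B)
  obtain ⟨h, hh⟩ := exists_eqOn_of_separatesPoints hf B χ
  exact ⟨h, Set.mem_iInter₂.2 fun a ha => hh a (Subgroup.subset_closure ha)⟩

/-- An injective homomorphism from a compact group `H` to the dual of a discrete torsion group `A`
which separates the points of `A`, as an isomorphism of topological groups. -/
def equivPontryaginDual [DiscreteTopology A] [CompactSpace H] (hA : IsMulTorsion A)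
    (f : H →* PontryaginDual A) (hcont : ∀ a, Continuous fun h => f h a)
    (hinj : Function.Injective f) (hf : ∀ a, (∀ h, f h a = 1) → a = 1) :
    H ≃ₜ* PontryaginDual A :=
  let e := MulEquiv.ofBijective f ⟨hinj, surjective_of_separatesPoints hA hcont hf⟩
  have he : Continuous e := ContinuousMonoidHom.continuous_of_continuous_uncurry f <|
    continuous_prod_of_discrete_right.2 hcont
  { e with
    continuous_toFun := he
    continuous_invFun := (he.homeoOfEquivCompactToT2 (f := e.toEquiv)).symm.continuous }

theorem equivPontryaginDual_apply [DiscreteTopology A] [CompactSpace H] (hA : IsMulTorsion A)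
    (f : H →* PontryaginDual A) (hcont : ∀ a, Continuous fun h => f h a)
    (hinj : Function.Injective f) (hf : ∀ a, (∀ h, f h a = 1) → a = 1) (h : H) :
    equivPontryaginDual hA f hcont hinj hf h = f h := rfl

end Pontryagin

variable {K : Type*} [Field K] [NumberField K]

/-! ### Weak approximation at finite places -/

theorem isNontrivial_adicAbv (v : HeightOneSpectrum (𝓞 K)) :
    (HeightOneSpectrum.adicAbv K v).IsNontrivial := by
  obtain ⟨x, hxv, hx⟩ := Submodule.exists_mem_ne_zero_of_ne_bot v.ne_bot
  refine ⟨x, by simpa using hx, ne_of_lt ?_⟩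
  rw [← FinitePlace.norm_embedding]
  exact (FinitePlace.norm_lt_one_iff_mem K v x).2 hxv

theorem not_isEquiv_adicAbv {v w : HeightOneSpectrum (𝓞 K)} (h : v ≠ w) :
    ¬ (HeightOneSpectrum.adicAbv K v).IsEquiv (HeightOneSpectrum.adicAbv K w) := by
  intro hvw
  have hle : v.asIdeal ≤ w.asIdeal := fun x hx => by
    rw [← FinitePlace.norm_lt_one_iff_mem K, FinitePlace.norm_embedding] at hx ⊢
    exact hvw.lt_one_iff.1 hx
  exact h (HeightOneSpectrum.ext (v.isMaximal.eq_of_le w.isPrime.ne_top hle))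

theorem denseRange_algebraMap_pi_adicCompletion {ι : Type*} [Finite ι]
    {v : ι → HeightOneSpectrum (𝓞 K)} (hv : Function.Injective v) :
    DenseRange (algebraMap K (∀ i, (v i).adicCompletion K)) := by
  let e (i : ι) (x : WithAbs (HeightOneSpectrum.adicAbv K (v i))) : (v i).adicCompletion K :=
    FinitePlace.embedding (v i) x.ofAbs
  have he (i : ι) : Isometry (e i) := Isometry.of_dist_eq fun x y => by
    rw [dist_eq_norm, dist_eq_norm, ← map_sub, FinitePlace.norm_embedding,
      WithAbs.norm_eq_apply_ofAbs, WithAbs.ofAbs_sub]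
  have hdense (i : ι) : DenseRange (e i) := by
    have := (v i).denseRange_algebraMap K
    rwa [DenseRange, ← (WithAbs.equiv (HeightOneSpectrum.adicAbv K (v i))).surjective.range_comp]
      at this
  exact (DenseRange.piMap hdense).comp (AbsoluteValue.denseRange_algebraMap_pi
    (fun i => isNontrivial_adicAbv (v i)) fun i j hij => not_isEquiv_adicAbv (hv.ne hij))
    (.piMap fun i => (he i).continuous)

/-! ### The places above a rational prime -/

theorem natCast_mem_asIdeal_iff (v : HeightOneSpectrum (𝓞 K)) {p : ℕ} (hp : p.Prime) :
    (p : 𝓞 K) ∈ v.asIdeal ↔ p = ringChar (𝓞 K ⧸ v.asIdeal) := by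
  have := v.isPrime
  have := Ideal.finiteQuotientOfFreeOfNeBot v.asIdeal v.ne_bot
  rw [← Ideal.Quotient.eq_zero_iff_mem, map_natCast, ringChar.spec, eq_comm,
    Nat.prime_dvd_prime_iff_eq (CharP.char_is_prime (𝓞 K ⧸ v.asIdeal) _) hp]

theorem exists_prime_mem_asIdeal (v : HeightOneSpectrum (𝓞 K)) :
    ∃ p : Nat.Primes, (p.1 : 𝓞 K) ∈ v.asIdeal := by
  have := v.isPrime
  have := Ideal.finiteQuotientOfFreeOfNeBot v.asIdeal v.ne_bot
  have hprime := CharP.char_is_prime (𝓞 K ⧸ v.asIdeal) (ringChar _)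
  exact ⟨⟨_, hprime⟩, (natCast_mem_asIdeal_iff v hprime).2 rfl⟩

theorem eq_of_prime_mem_asIdeal {v : HeightOneSpectrum (𝓞 K)} {p q : Nat.Primes}
    (hp : (p.1 : 𝓞 K) ∈ v.asIdeal) (hq : (q.1 : 𝓞 K) ∈ v.asIdeal) : p = q :=
  Subtype.ext <| ((natCast_mem_asIdeal_iff v p.2).1 hp).trans
    ((natCast_mem_asIdeal_iff v q.2).1 hq).symm

theorem mem_adicCompletionIntegers_iff_norm_le_one {v : HeightOneSpectrum (𝓞 K)}
    {x : v.adicCompletion K} : x ∈ v.adicCompletionIntegers K ↔ ‖x‖ ≤ 1 := by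
  rw [HeightOneSpectrum.mem_adicCompletionIntegers, FinitePlace.norm_def, NNReal.coe_le_one]
  exact ((WithZeroMulInt.toNNReal_strictMono
    (HeightOneSpectrum.one_lt_absNorm_nnreal v)).le_iff_le (b := 1)).symm

theorem algebraMap_mem_adicCompletionIntegers (v : HeightOneSpectrum (𝓞 K)) (x : 𝓞 K) :
    algebraMap K (v.adicCompletion K) x ∈ v.adicCompletionIntegers K :=
  mem_adicCompletionIntegers_iff_norm_le_one.2 (FinitePlace.norm_le_one K v x)

variable (K) in
/-- The finite places of `K` above the prime number `p`. -/
abbrev PlacesOver (p : ℕ) : Type _ := {v : HeightOneSpectrum (𝓞 K) // (p : 𝓞 K) ∈ v.asIdeal}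

variable (K) in
/-- The product `∏_{v ∣ p} K_v` of the completions of `K` at the places above `p`, which is
`K ⊗ ℚ_p`. -/
abbrev LocalProduct (p : ℕ) : Type _ := ∀ w : PlacesOver K p, w.1.adicCompletion K

variable (K) in
/-- The index type of the integral basis of `K`. -/
abbrev BasisIndex : Type _ := Module.Free.ChooseBasisIndex ℤ (𝓞 K)

section LocalProduct

variable {p : ℕ} [Fact p.Prime]

instance : Finite (PlacesOver K p) := by
  have h0 : Ideal.span {(p : 𝓞 K)} ≠ 0 := by
    simpa using (Fact.out : p.Prime).ne_zero
  exact Set.Finite.to_subtype ((Ideal.finite_factors h0).subset fun v hv =>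
    Ideal.dvd_span_singleton.2 hv)

instance : Fintype (PlacesOver K p) := Fintype.ofFinite _

instance (w : PlacesOver K p) : Algebra ℚ_[p] (w.1.adicCompletion K) :=
  (padicToCompletion w.1 p w.2).toAlgebra

theorem continuous_padicToCompletion (w : PlacesOver K p) :
    Continuous (padicToCompletion w.1 p w.2) :=
  UniformSpace.Completion.continuous_extension.comp
    (Padic.withValUniformEquiv (p := p)).symm.continuous

instance (w : PlacesOver K p) : ContinuousSMul ℚ_[p] (w.1.adicCompletion K) where
  continuous_smul := by
    simp only [Algebra.smul_def]
    exact ((continuous_padicToCompletion w).comp continuous_fst).mul continuous_snd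

theorem smul_mem_adicCompletionIntegers (w : PlacesOver K p) (z : ℤ_[p])
    {x : w.1.adicCompletion K} (hx : x ∈ w.1.adicCompletionIntegers K) :
    (z : ℚ_[p]) • x ∈ w.1.adicCompletionIntegers K := by
  refine mul_mem (?_ : padicToCompletion w.1 p w.2 z ∈ w.1.adicCompletionIntegers K) hx
  induction z using PadicInt.denseRange_natCast.induction_on with
  | hp =>
    simp only [mem_adicCompletionIntegers_iff_norm_le_one]
    exact isClosed_le ((continuous_padicToCompletion w).comp continuous_subtype_val).norm
      continuous_const
  | ih n =>
    rw [PadicInt.coe_natCast, map_natCast]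
    exact natCast_mem _ n

/-! ### An integral basis of `K` is a basis of the product of the completions above `p` -/

theorem exists_natCast_mul_mem_integers (s : Finset K) :
    ∃ N : ℕ, N ≠ 0 ∧ ∀ k ∈ s, (N : K) * k ∈ (algebraMap (𝓞 K) K).range := by
  obtain ⟨m, hm, h⟩ := exists_integral_multiples ℤ ℚ s
  refine ⟨m.natAbs, Int.natAbs_ne_zero.2 hm, fun k hk => ?_⟩
  suffices IsIntegral ℤ ((m.natAbs : K) * k) from ⟨⟨_, this⟩, rfl⟩
  have hmk : IsIntegral ℤ ((m : K) * k) := by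
    rw [← zsmul_eq_mul]
    exact h k hk
  obtain hm | hm := m.natAbs_eq
  · rwa [hm, Int.cast_natCast] at hmk
  · rwa [hm, Int.cast_neg, Int.cast_natCast, neg_mul, IsIntegral.neg_iff] at hmk

theorem exists_natCast_mul_mem_integers_of_norm_le_one {k : K}
    (hk : ∀ w : PlacesOver K p, ‖algebraMap K (w.1.adicCompletion K) k‖ ≤ 1) :
    ∃ s : ℕ, ¬ p ∣ s ∧ (s : K) * k ∈ (algebraMap (𝓞 K) K).range := by
  obtain ⟨N, hN, h⟩ := exists_natCast_mul_mem_integers {k}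
  obtain ⟨x, hx⟩ := h k (Finset.mem_singleton_self k)
  obtain ⟨m, s, hs, rfl⟩ := Nat.exists_eq_pow_mul_and_not_dvd hN p (Fact.out : p.Prime).ne_one
  refine ⟨s, hs, HeightOneSpectrum.mem_integers_of_valuation_le_one K _ fun v => ?_⟩
  rw [← HeightOneSpectrum.valuedAdicCompletion_eq_valuation']
  change algebraMap K (v.adicCompletion K) (s * k) ∈ v.adicCompletionIntegers K
  by_cases hv : (p : 𝓞 K) ∈ v.asIdeal
  · rw [map_mul, map_natCast]
    exact mul_mem (natCast_mem _ s) (mem_adicCompletionIntegers_iff_norm_le_one.2 (hk ⟨v, hv⟩))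
  · have hp : ‖algebraMap K (v.adicCompletion K) (algebraMap (𝓞 K) K p)‖ = 1 :=
      (FinitePlace.norm_eq_one_iff_notMem K v _).2 hv
    have hsk : ‖algebraMap K (v.adicCompletion K) (p ^ m * (s * k))‖ ≤ 1 := by
      rw [← mul_assoc, ← Nat.cast_pow, ← Nat.cast_mul, ← hx]
      exact FinitePlace.norm_le_one K v x
    rw [map_natCast] at hp
    rw [mem_adicCompletionIntegers_iff_norm_le_one]
    rwa [map_mul, map_pow, norm_mul, norm_pow, hp, one_pow, one_mul] at hsk

theorem repr_integralBasis_mem_padicInt {k : K}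
    (hk : ∀ w : PlacesOver K p, algebraMap K (w.1.adicCompletion K) k ∈
      w.1.adicCompletionIntegers K) (i : BasisIndex K) :
    ((integralBasis K).repr k i : ℚ_[p]) ∈ PadicInt.subring p := by
  obtain ⟨s, hs, x, hx⟩ := exists_natCast_mul_mem_integers_of_norm_le_one fun w =>
    mem_adicCompletionIntegers_iff_norm_le_one.1 (hk w)
  have hrepr : (s : ℚ) * (integralBasis K).repr k i = ((RingOfIntegers.basis K).repr x i : ℤ) := by
    rw [← eq_intCast (algebraMap ℤ ℚ), ← integralBasis_repr_apply, hx, ← nsmul_eq_mul,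
      ← nsmul_eq_mul, map_nsmul, Finsupp.smul_apply]
  have hs : ‖(s : ℚ_[p])‖ = 1 :=
    Padic.norm_natCast_eq_one_iff.2 ((Fact.out : p.Prime).coprime_iff_not_dvd.2 hs)
  have hnorm := congrArg (fun q : ℚ => ‖(q : ℚ_[p])‖) hrepr
  simp only [Rat.cast_mul, Rat.cast_natCast, Rat.cast_intCast, norm_mul, hs, one_mul] at hnorm
  exact hnorm.trans_le (Padic.norm_int_le_one _)

theorem algebraMap_localProduct_eq_sum_repr {ι : Type*} [Fintype ι] (b : Module.Basis ι ℚ K)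
    (k : K) : algebraMap K (LocalProduct K p) k =
      ∑ i, (b.repr k i : ℚ_[p]) • algebraMap K (LocalProduct K p) (b i) := by
  have hsmul (q : ℚ) (x : K) : algebraMap K (LocalProduct K p) (q • x) =
      (q : ℚ_[p]) • algebraMap K (LocalProduct K p) x := by
    funext w
    change algebraMap K (w.1.adicCompletion K) (q • x) = padicToCompletion w.1 p w.2 q * _
    rw [Rat.smul_def, map_mul, map_ratCast, map_ratCast]
    rfl
  conv_lhs => rw [← b.sum_repr k, map_sum]
  simp only [hsmul]

theorem sum_smul_integralBasis_mem {c : BasisIndex K → ℚ_[p]}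
    (hc : ∀ i, c i ∈ PadicInt.subring p) (w : PlacesOver K p) :
    (∑ i, c i • algebraMap K (LocalProduct K p) (integralBasis K i)) w ∈
      w.1.adicCompletionIntegers K := by
  rw [Finset.sum_apply]
  refine sum_mem fun i _ => smul_mem_adicCompletionIntegers w ⟨c i, hc i⟩ ?_
  rw [integralBasis_apply]
  exact algebraMap_mem_adicCompletionIntegers w.1 _

-- Modulo `ℤ_p` the coefficients are rational, so that the claim is one about elements of `K`.
theorem mem_padicInt_of_sum_smul_integralBasis_mem {c : BasisIndex K → ℚ_[p]}
    (hc : ∀ w, (∑ i, c i • algebraMap K (LocalProduct K p) (integralBasis K i)) w ∈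
      w.1.adicCompletionIntegers K) (i : BasisIndex K) : c i ∈ PadicInt.subring p := by
  choose q _ hq using fun i => exists_padic_principalPart p (c i)
  let k : K := ∑ i, q i • integralBasis K i
  have hrepr (i) : (integralBasis K).repr k i = q i := by
    rw [Module.Basis.repr_sum_self]
  have hk : algebraMap K (LocalProduct K p) k =
      ∑ i, c i • algebraMap K (LocalProduct K p) (integralBasis K i) -
        ∑ i, (c i - q i) • algebraMap K (LocalProduct K p) (integralBasis K i) := by
    rw [algebraMap_localProduct_eq_sum_repr (integralBasis K)]
    simp only [hrepr, sub_smul, Finset.sum_sub_distrib, sub_sub_cancel]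
  have hqi := repr_integralBasis_mem_padicInt (p := p) (k := k) (fun w => by
    change algebraMap K (LocalProduct K p) k w ∈ _
    rw [hk]
    exact sub_mem (hc w) (sum_smul_integralBasis_mem hq w)) i
  rw [hrepr] at hqi
  simpa only [sub_add_cancel] using add_mem (hq i) hqi

theorem padic_eq_zero_of_forall_div_pow_mem {x : ℚ_[p]}
    (h : ∀ n : ℕ, x / (p : ℚ_[p]) ^ n ∈ PadicInt.subring p) : x = 0 := by
  by_contra hx
  obtain ⟨n, hn⟩ := exists_pow_lt_of_lt_one (norm_pos_iff.2 hx) (Padic.norm_p_lt_one (p := p))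
  have hp : 0 < ‖(p : ℚ_[p])‖ := norm_pos_iff.2 (mod_cast (Fact.out : p.Prime).ne_zero)
  have hxn : ‖x / (p : ℚ_[p]) ^ n‖ ≤ 1 := h n
  rw [norm_div, norm_pow, div_le_one (pow_pos hp n)] at hxn
  exact hxn.not_gt hn

theorem linearIndependent_integralBasis :
    LinearIndependent ℚ_[p] fun i => algebraMap K (LocalProduct K p) (integralBasis K i) := by
  rw [Fintype.linearIndependent_iff]
  refine fun c hc i => padic_eq_zero_of_forall_div_pow_mem fun n => ?_
  refine mem_padicInt_of_sum_smul_integralBasis_mem (c := fun i => c i / (p : ℚ_[p]) ^ n)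
    (fun w => ?_) i
  simp only [div_eq_inv_mul, mul_smul]
  rw [← Finset.smul_sum, hc, smul_zero]
  exact zero_mem _

theorem span_integralBasis_eq_top : Submodule.span ℚ_[p]
    (Set.range fun i => algebraMap K (LocalProduct K p) (integralBasis K i)) = ⊤ := by
  set S := Submodule.span ℚ_[p]
    (Set.range fun i => algebraMap K (LocalProduct K p) (integralBasis K i))
  have : FiniteDimensional ℚ_[p] S := FiniteDimensional.span_of_finite _ (Set.finite_range _)
  have hclosed : IsClosed (S : Set (LocalProduct K p)) := S.closed_of_finiteDimensional
  have hdense : DenseRange (algebraMap K (LocalProduct K p)) :=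
    denseRange_algebraMap_pi_adicCompletion Subtype.val_injective
  have hle : Set.range (algebraMap K (LocalProduct K p)) ⊆ S := by
    rintro _ ⟨k, rfl⟩
    rw [algebraMap_localProduct_eq_sum_repr (integralBasis K)]
    exact sum_mem fun i _ => S.smul_mem _ (Submodule.subset_span ⟨i, rfl⟩)
  refine SetLike.coe_injective (Set.univ_subset_iff.1 ?_)
  exact hdense.closure_range.ge.trans (closure_minimal hle hclosed)

variable (K p) in
/-- An integral basis of `K`, as a basis over `ℚ_p` of the product of the completions of `K` at
the places above `p`. -/
def localBasis : Module.Basis (BasisIndex K) ℚ_[p] (LocalProduct K p) :=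
  Module.Basis.mk linearIndependent_integralBasis span_integralBasis_eq_top.ge

theorem localBasis_apply (i : BasisIndex K) :
    localBasis K p i = algebraMap K (LocalProduct K p) (integralBasis K i) :=
  Module.Basis.mk_apply _ _ _

theorem localBasis_repr_algebraMap (k : K) (i : BasisIndex K) :
    (localBasis K p).repr (algebraMap K (LocalProduct K p) k) i = (integralBasis K).repr k i := by
  rw [algebraMap_localProduct_eq_sum_repr (integralBasis K)]
  simp only [← localBasis_apply]
  rw [Module.Basis.repr_sum_self]

theorem forall_mem_adicCompletionIntegers_iff (a : LocalProduct K p) :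
    (∀ w, a w ∈ w.1.adicCompletionIntegers K) ↔
      ∀ i, (localBasis K p).repr a i ∈ PadicInt.subring p := by
  have ha : a = ∑ i, (localBasis K p).repr a i •
      algebraMap K (LocalProduct K p) (integralBasis K i) := by
    simpa only [localBasis_apply] using ((localBasis K p).sum_repr a).symm
  constructor
  · intro h
    refine mem_padicInt_of_sum_smul_integralBasis_mem fun w => ?_
    rw [← ha]
    exact h w
  · intro h w
    rw [ha]
    exact sum_smul_integralBasis_mem h w

instance : FiniteDimensional ℚ_[p] (LocalProduct K p) :=
  (localBasis K p).finiteDimensional_of_finite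

instance (w : PlacesOver K p) : FiniteDimensional ℚ_[p] (w.1.adicCompletion K) :=
  Module.Finite.of_surjective
    (LinearMap.proj w : LocalProduct K p →ₗ[ℚ_[p]] w.1.adicCompletion K)
    (Function.surjective_eval w)

/-! ### The trace form on the product of the completions above `p` -/

theorem trace_pi_apply {R ι : Type*} [CommRing R] [Fintype ι] {A : ι → Type*}
    [∀ i, CommRing (A i)] [∀ i, Algebra R (A i)] [∀ i, Module.Free R (A i)]
    [∀ i, Module.Finite R (A i)] (x : ∀ i, A i) :
    Algebra.trace R (∀ i, A i) x = ∑ i, Algebra.trace R (A i) (x i) := by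
  classical
  have h : Algebra.lmul R (∀ i, A i) x = ∑ i, LinearMap.single R A i ∘ₗ
      (Algebra.lmul R (A i) (x i) ∘ₗ LinearMap.proj i) := by
    refine LinearMap.ext fun y => funext fun j => ?_
    simp only [LinearMap.sum_apply, Finset.sum_apply, LinearMap.comp_apply, LinearMap.proj_apply,
      LinearMap.single_apply]
    rw [Finset.sum_pi_single]
    simp
  rw [Algebra.trace_apply, h, map_sum]
  refine Finset.sum_congr rfl fun i _ => ?_
  rw [LinearMap.trace_comp_comm', LinearMap.comp_assoc, LinearMap.proj_comp_single_same,
    LinearMap.comp_id, Algebra.trace_apply]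

theorem trace_localProduct_apply (x : LocalProduct K p) :
    Algebra.trace ℚ_[p] (LocalProduct K p) x = ∑ w : PlacesOver K p, finiteTrace w.1 p w.2 (x w) :=
  trace_pi_apply x

theorem trace_localProduct_algebraMap (k : K) :
    Algebra.trace ℚ_[p] (LocalProduct K p) (algebraMap K (LocalProduct K p) k) =
      (Algebra.trace ℚ K k : ℚ_[p]) := by
  classical
  have h : Algebra.leftMulMatrix (localBasis K p) (algebraMap K (LocalProduct K p) k) =
      (Algebra.leftMulMatrix (integralBasis K) k).map (Rat.castHom ℚ_[p]) := by
    ext i j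
    rw [Algebra.leftMulMatrix_eq_repr_mul, Matrix.map_apply, Algebra.leftMulMatrix_eq_repr_mul,
      localBasis_apply, ← map_mul, localBasis_repr_algebraMap, Rat.coe_castHom]
  rw [Algebra.trace_eq_matrix_trace (localBasis K p), h,
    Algebra.trace_eq_matrix_trace (integralBasis K)]
  exact (AddMonoidHom.map_trace (Rat.castHom ℚ_[p]) _).symm

variable (K) in
/-- The basis of `K` dual to the integral basis with respect to the trace form. -/
def dualIntegralBasis : Module.Basis (BasisIndex K) ℚ K :=
  open Classical in (integralBasis K).traceDual

theorem trace_mul_dualIntegralBasis (k : K) (i : BasisIndex K) :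
    Algebra.trace ℚ K (k * dualIntegralBasis K i) = (integralBasis K).repr k i := by
  classical
  rw [← Algebra.traceForm_apply, ← Module.Basis.traceDual_repr_apply, dualIntegralBasis,
    Module.Basis.traceDual_traceDual]

theorem sum_trace_smul_dualIntegralBasis (d : LocalProduct K p) :
    ∑ i, Algebra.trace ℚ_[p] (LocalProduct K p)
        (algebraMap K (LocalProduct K p) (integralBasis K i) * d) •
      algebraMap K (LocalProduct K p) (dualIntegralBasis K i) = d := by
  let L := LocalProduct K p
  let expansion : L →ₗ[ℚ_[p]] L := ∑ i, (Algebra.trace ℚ_[p] L ∘ₗ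
    LinearMap.mulLeft ℚ_[p] (algebraMap K L (integralBasis K i))).smulRight
      (algebraMap K L (dualIntegralBasis K i))
  suffices expansion = LinearMap.id by
    simpa [expansion] using LinearMap.congr_fun this d
  refine (localBasis K p).ext fun j => ?_
  rw [LinearMap.id_apply, localBasis_apply]
  conv_rhs => rw [algebraMap_localProduct_eq_sum_repr (dualIntegralBasis K)]
  simp only [expansion, LinearMap.sum_apply, LinearMap.smulRight_apply, LinearMap.comp_apply,
    LinearMap.mulLeft_apply]
  refine Finset.sum_congr rfl fun i _ => ?_
  rw [← map_mul, trace_localProduct_algebraMap, dualIntegralBasis,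
    Module.Basis.traceDual_repr_apply, Algebra.traceForm_apply, mul_comm]

theorem mem_localInverseDifferent_iff (w : PlacesOver K p) (b : w.1.adicCompletion K) :
    b ∈ localInverseDifferent w.1 ↔
      ∀ a ∈ w.1.adicCompletionIntegers K, finiteTrace w.1 p w.2 (a * b) ∈ PadicInt.subring p := by
  refine ⟨fun h => h ⟨p, Fact.out⟩ w.2, fun h q hq a ha => ?_⟩
  obtain rfl := eq_of_prime_mem_asIdeal (p := ⟨p, Fact.out⟩) w.2 hq
  exact h a ha

theorem forall_mem_localInverseDifferent_iff (d : LocalProduct K p) :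
    (∀ w, d w ∈ localInverseDifferent w.1) ↔
      ∀ a : LocalProduct K p, (∀ w, a w ∈ w.1.adicCompletionIntegers K) →
        Algebra.trace ℚ_[p] (LocalProduct K p) (a * d) ∈ PadicInt.subring p := by
  classical
  simp only [mem_localInverseDifferent_iff]
  refine ⟨fun h a ha => ?_, fun h w x hx => ?_⟩
  · rw [trace_localProduct_apply]
    exact sum_mem fun w _ => h w _ (ha w)
  · have hsingle : Algebra.trace ℚ_[p] (LocalProduct K p) (Pi.single w x * d) =
        finiteTrace w.1 p w.2 (x * d w) := by
      rw [trace_localProduct_apply]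
      refine (Finset.sum_eq_single w (fun w' _ hne => ?_) (by simp)).trans ?_
      · rw [Pi.mul_apply, Pi.single_eq_of_ne hne, zero_mul]
        exact map_zero (Algebra.trace ℚ_[p] (w'.1.adicCompletion K))
      · rw [Pi.mul_apply, Pi.single_eq_same]
    rw [← hsingle]
    refine h _ fun w' => ?_
    obtain rfl | hne := eq_or_ne w' w
    · rwa [Pi.single_eq_same]
    · rw [Pi.single_eq_of_ne hne]
      exact zero_mem _

theorem forall_mem_localInverseDifferent_iff_integralBasis (d : LocalProduct K p) :
    (∀ w, d w ∈ localInverseDifferent w.1) ↔ ∀ i, Algebra.trace ℚ_[p] (LocalProduct K p)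
      (algebraMap K (LocalProduct K p) (integralBasis K i) * d) ∈ PadicInt.subring p := by
  rw [forall_mem_localInverseDifferent_iff]
  refine ⟨fun h i => h _ fun w => ?_, fun h a ha => ?_⟩
  · rw [integralBasis_apply]
    exact algebraMap_mem_adicCompletionIntegers w.1 _
  · rw [← (localBasis K p).sum_repr a, Finset.sum_mul, map_sum]
    refine sum_mem fun i _ => ?_
    rw [smul_mul_assoc, map_smul, smul_eq_mul, localBasis_apply]
    exact mul_mem ((forall_mem_adicCompletionIntegers_iff a).1 ha i) (h i)

theorem algebraMap_dualIntegralBasis_mem (i : BasisIndex K) (w : PlacesOver K p) :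
    algebraMap K (w.1.adicCompletion K) (dualIntegralBasis K i) ∈ localInverseDifferent w.1 := by
  refine (forall_mem_localInverseDifferent_iff_integralBasis
    (algebraMap K (LocalProduct K p) (dualIntegralBasis K i))).2 (fun j => ?_) w
  classical
  rw [← map_mul, trace_localProduct_algebraMap, trace_mul_dualIntegralBasis,
    Module.Basis.repr_self, Finsupp.single_apply]
  split_ifs <;> simp

theorem isCompact_pi_localInverseDifferent :
    IsCompact (Set.univ.pi fun w : PlacesOver K p =>
      (localInverseDifferent w.1 : Set (w.1.adicCompletion K))) := by
  let L := LocalProduct K p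
  let coord (i : BasisIndex K) : L →ₗ[ℚ_[p]] ℚ_[p] :=
    Algebra.trace ℚ_[p] L ∘ₗ LinearMap.mulLeft ℚ_[p] (algebraMap K L (integralBasis K i))
  let combination (c : BasisIndex K → ℤ_[p]) : L :=
    ∑ i, (c i : ℚ_[p]) • algebraMap K L (dualIntegralBasis K i)
  have hpi : (Set.univ.pi fun w : PlacesOver K p =>
      (localInverseDifferent w.1 : Set (w.1.adicCompletion K))) = {d | ∀ i, ‖coord i d‖ ≤ 1} :=
    Set.ext fun d => Set.mem_univ_pi.trans (forall_mem_localInverseDifferent_iff_integralBasis d)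
  have hcombination : Continuous combination := continuous_finsetSum _ fun i _ => by fun_prop
  rw [hpi, Set.ofPred_forall]
  refine (isCompact_range hcombination).of_isClosed_subset (isClosed_iInter fun i => ?_)
    fun d hd => ?_
  · exact isClosed_le (coord i).continuous_of_finiteDimensional.norm continuous_const
  · exact ⟨fun i => ⟨coord i d, Set.mem_iInter.1 hd i⟩, sum_trace_smul_dualIntegralBasis d⟩

end LocalProduct

theorem isCompact_localInverseDifferent (v : HeightOneSpectrum (𝓞 K)) :
    IsCompact (localInverseDifferent v : Set (v.adicCompletion K)) := by
  obtain ⟨p, hv⟩ := exists_prime_mem_asIdeal v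
  have h := (isCompact_pi_localInverseDifferent (K := K) (p := p.1)).image
    (continuous_apply (⟨v, hv⟩ : PlacesOver K p.1))
  rwa [Set.eval_image_univ_pi ⟨0, fun w _ => (localInverseDifferent w.1).zero_mem⟩] at h

/-! ### The product of the local inverse differents in the adeles -/

variable (K) in
theorem exists_mul_mem_adicCompletionIntegers :
    ∃ N : K, N ≠ 0 ∧ ∀ (v : HeightOneSpectrum (𝓞 K)), ∀ b ∈ localInverseDifferent v,
      algebraMap K (v.adicCompletion K) N * b ∈ v.adicCompletionIntegers K := by
  classical
  obtain ⟨N, hN0, hN⟩ := exists_natCast_mul_mem_integers (Finset.univ.image (dualIntegralBasis K))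
  refine ⟨N, Nat.cast_ne_zero.2 hN0, fun v b hb => ?_⟩
  obtain ⟨p, hv⟩ := exists_prime_mem_asIdeal v
  obtain ⟨w, rfl⟩ : ∃ w : PlacesOver K p.1, w.1 = v := ⟨⟨v, hv⟩, rfl⟩
  let D : Set (LocalProduct K p.1) := Set.univ.pi fun w => localInverseDifferent w.1
  obtain ⟨d, hd, rfl⟩ : b ∈ Function.eval w '' D := by
    rwa [Set.eval_image_univ_pi ⟨0, fun w _ => (localInverseDifferent w.1).zero_mem⟩]
  have htrace := (forall_mem_localInverseDifferent_iff_integralBasis d).1 (Set.mem_univ_pi.1 hd)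
  rw [← sum_trace_smul_dualIntegralBasis d, Function.eval, Finset.sum_apply, Finset.mul_sum]
  refine sum_mem fun i _ => ?_
  rw [Pi.smul_apply, mul_smul_comm]
  refine smul_mem_adicCompletionIntegers w ⟨_, htrace i⟩ ?_
  obtain ⟨x, hx⟩ := hN _ (Finset.mem_image_of_mem _ (Finset.mem_univ i))
  rw [Pi.algebraMap_apply, ← map_mul, ← hx]
  exact algebraMap_mem_adicCompletionIntegers w.1 x

variable (K) in
theorem exists_continuous_finiteAdele :
    ∃ f : (∀ v : HeightOneSpectrum (𝓞 K), localInverseDifferent v) → FiniteAdeleRing (𝓞 K) K,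
      Continuous f ∧ ∀ d v, f d v = d v := by
  obtain ⟨N, hN0, hN⟩ := exists_mul_mem_adicCompletionIntegers K
  -- The product topology is the adelic topology only on `∏ 𝓞_v`, so we scale by `N` to land there.
  let g : (∀ v : HeightOneSpectrum (𝓞 K), localInverseDifferent v) →
      FiniteAdeleRing (𝓞 K) K := fun d =>
    RestrictedProduct.structureMap (fun v : HeightOneSpectrum (𝓞 K) => v.adicCompletion K)
      (fun v => (v.adicCompletionIntegers K : Set (v.adicCompletion K))) Filter.cofinite
      fun v => ⟨algebraMap K (v.adicCompletion K) N * d v, hN v _ (d v).2⟩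
  have hg : Continuous g := by
    refine RestrictedProduct.isEmbedding_structureMap.continuous.comp ?_
    refine continuous_pi fun v => Continuous.subtype_mk ?_ _
    exact continuous_const.mul (continuous_subtype_val.comp (continuous_apply v))
  refine ⟨fun d => algebraMap K (FiniteAdeleRing (𝓞 K) K) N⁻¹ * g d,
    continuous_const.mul hg, fun d v => ?_⟩
  change algebraMap K (v.adicCompletion K) N⁻¹ *
    (algebraMap K (v.adicCompletion K) N * d v) = _
  rw [← mul_assoc, ← map_mul, inv_mul_cancel₀ hN0, map_one, one_mul]

theorem continuous_adele_apply (v : HeightOneSpectrum (𝓞 K)) :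
    Continuous fun b : AdeleRing (𝓞 K) K => b.2 v :=
  (RestrictedProduct.continuous_eval v).comp continuous_snd

variable (K) in
theorem exists_inverseDifferent_continuousAddEquiv :
    ∃ ι : (∀ v : HeightOneSpectrum (𝓞 K), localInverseDifferent v) ≃ₜ+ adelicInverseDifferent K,
      ∀ d, (ι d : AdeleRing (𝓞 K) K).1 = 0 ∧
        ∀ v : HeightOneSpectrum (𝓞 K), (ι d : AdeleRing (𝓞 K) K).2 v = d v := by
  obtain ⟨f, hf, hfd⟩ := exists_continuous_finiteAdele K
  let ι : (∀ v : HeightOneSpectrum (𝓞 K), localInverseDifferent v) ≃ₜ+ adelicInverseDifferent K :=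
    { toFun := fun d => ⟨((0, f d) : InfiniteAdeleRing K × FiniteAdeleRing (𝓞 K) K), rfl,
        fun v => (hfd d v).symm ▸ (d v).2⟩
      invFun := fun b v => ⟨(b : AdeleRing (𝓞 K) K).2 v, b.2.2 v⟩
      left_inv := fun d => funext fun v => Subtype.ext (hfd d v)
      right_inv := fun b => Subtype.ext
        (Prod.ext b.2.1.symm (FiniteAdeleRing.ext K fun v => hfd _ v))
      map_add' := fun d d' => Subtype.ext (Prod.ext (add_zero 0).symm
        (FiniteAdeleRing.ext K fun v =>
          (hfd _ v).trans (congrArg₂ (· + ·) (hfd d v) (hfd d' v)).symm))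
      continuous_toFun := Continuous.subtype_mk (continuous_const.prodMk hf) _
      continuous_invFun := continuous_pi fun v => Continuous.subtype_mk
        ((continuous_adele_apply v).comp continuous_subtype_val) _ }
  exact ⟨ι, fun d => ⟨rfl, hfd d⟩⟩

instance : CompactSpace (adelicInverseDifferent K) := by
  have (v : HeightOneSpectrum (𝓞 K)) : CompactSpace (localInverseDifferent v) :=
    isCompact_iff_compactSpace.1 (isCompact_localInverseDifferent v)
  obtain ⟨ι, -⟩ := exists_inverseDifferent_continuousAddEquiv K
  exact ι.toHomeomorph.compactSpace

/-! ### The characters `χ_p` -/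

theorem exp_two_pi_mul_eq_one_iff (r : ℚ) :
    Circle.exp (2 * Real.pi * (r : ℝ)) = 1 ↔ ∃ m : ℤ, r = m := by
  rw [Circle.exp_eq_one]
  refine exists_congr fun m => ?_
  rw [mul_comm (2 * Real.pi), mul_left_inj' Real.two_pi_pos.ne']
  exact_mod_cast Iff.rfl

theorem ratCast_mem_padicInt_iff {p : ℕ} [Fact p.Prime] {q : ℚ} :
    (q : ℚ_[p]) ∈ PadicInt.subring p ↔ ¬ p ∣ q.den := by
  refine ⟨fun hq hden => ?_, fun h => Padic.norm_rat_le_one h⟩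
  have hnum : ‖((q.num : ℤ) : ℚ_[p])‖ < 1 := by
    rw [← Rat.cast_intCast, ← Rat.mul_den_eq_num q, Rat.cast_mul, Rat.cast_natCast, norm_mul]
    exact mul_lt_one_of_nonneg_of_lt_one_right hq (norm_nonneg _)
      (Padic.norm_natCast_lt_one_iff.2 hden)
  have hdvd := Nat.dvd_gcd (Int.natCast_dvd.1 (Padic.norm_intCast_lt_one_iff.1 hnum)) hden
  exact (Fact.out : p.Prime).not_dvd_one (q.reduced ▸ hdvd)

theorem exists_eq_intCast_iff_forall_mem_padicInt {q : ℚ} :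
    (∃ m : ℤ, q = m) ↔ ∀ p : Nat.Primes, (q : ℚ_[p.1]) ∈ PadicInt.subring p.1 := by
  simp only [ratCast_mem_padicInt_iff]
  refine ⟨?_, fun h => ⟨q.num, ?_⟩⟩
  · rintro ⟨m, rfl⟩ p
    rw [Rat.den_intCast]
    exact p.2.not_dvd_one
  · have hden : q.den = 1 := Nat.eq_one_iff_not_exists_prime_dvd.2 fun p hp => h ⟨p, hp⟩
    exact ((Rat.den_eq_one_iff q).1 hden).symm

section PadicChar

variable {p : ℕ} [Fact p.Prime]

theorem sub_principalPart_mem (x : ℚ_[p]) :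
    x - (principalPart p x : ℚ_[p]) ∈ PadicInt.subring p :=
  (exists_padic_principalPart p x).choose_spec.2

theorem principalPart_mem_padicInt {l : ℕ} [Fact l.Prime] (hl : l ≠ p) (x : ℚ_[p]) :
    (principalPart p x : ℚ_[l]) ∈ PadicInt.subring l := by
  obtain ⟨m, n, h⟩ := (exists_padic_principalPart p x).choose_spec.1
  change principalPart p x = _ at h
  have hp : ‖(p : ℚ_[l])‖ = 1 := Padic.norm_natCast_eq_one_iff.2
    ((Nat.coprime_primes Fact.out Fact.out).2 hl)
  change ‖_‖ ≤ 1
  rw [h, Rat.cast_div, Rat.cast_pow, Rat.cast_natCast, Rat.cast_intCast, norm_div, norm_pow, hp,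
    one_pow, div_one]
  exact Padic.norm_int_le_one m

theorem padicChar_add (x y : ℚ_[p]) :
    padicChar p (x + y) = padicChar p x * padicChar p y := by
  rw [eq_comm, ← div_eq_one, padicChar, padicChar, padicChar, ← Circle.exp_add, ← Circle.exp_sub,
    ← mul_add, ← mul_sub, ← Rat.cast_add, ← Rat.cast_sub, exp_two_pi_mul_eq_one_iff,
    exists_eq_intCast_iff_forall_mem_padicInt]
  intro l
  by_cases hl : l.1 = p
  · subst hl
    have h := sub_mem (sub_principalPart_mem (x + y))
      (add_mem (sub_principalPart_mem x) (sub_principalPart_mem y))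
    push_cast
    convert h using 1
    ring
  · rw [Rat.cast_sub, Rat.cast_add]
    exact sub_mem (add_mem (principalPart_mem_padicInt hl x) (principalPart_mem_padicInt hl y))
      (principalPart_mem_padicInt hl (x + y))

theorem padicChar_eq_one_iff {x : ℚ_[p]} : padicChar p x = 1 ↔ x ∈ PadicInt.subring p := by
  have hx : x ∈ PadicInt.subring p ↔ (principalPart p x : ℚ_[p]) ∈ PadicInt.subring p := by
    rw [← add_mem_cancel_left (sub_principalPart_mem x) (y := (principalPart p x : ℚ_[p])),
      sub_add_cancel]
  rw [padicChar, exp_two_pi_mul_eq_one_iff, exists_eq_intCast_iff_forall_mem_padicInt, hx]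
  refine ⟨fun h => h ⟨p, Fact.out⟩, fun h l => ?_⟩
  by_cases hl : l.1 = p
  · subst hl
    exact h
  · exact principalPart_mem_padicInt hl x

variable (p) in
theorem continuous_padicChar : Continuous (padicChar p) := by
  refine continuous_iff_continuousAt.2 fun x => ?_
  refine continuousAt_const.congr (f := fun _ => padicChar p x) ?_
  filter_upwards [Metric.ball_mem_nhds x one_pos] with y hy
  have hyx : y - x ∈ PadicInt.subring p := (mem_ball_iff_norm.1 hy).le
  rw [← sub_add_cancel y x, padicChar_add, padicChar_eq_one_iff.2 hyx, one_mul]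

end PadicChar

/-! ### The local factors of the canonical pairing -/

/-- The components of an adele at the places above `p`. -/
def localComponent (p : ℕ) (b : AdeleRing (𝓞 K) K) : LocalProduct K p := fun w => b.2 w.1

/-- The factor `χ_p(∑_{v ∣ p} Tr_{K_v/ℚ_p}(k b_v))` at `p` of the canonical pairing `⟨k, b⟩` of
an element of `K` with an adele. -/
def localPairing (p : ℕ) [Fact p.Prime] (k : K) (b : AdeleRing (𝓞 K) K) : Circle :=
  padicChar p (Algebra.trace ℚ_[p] (LocalProduct K p)
    (algebraMap K (LocalProduct K p) k * localComponent p b))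

theorem adelicTrace_fst_eq_zero (a : AdeleRing (𝓞 K) K) {b : AdeleRing (𝓞 K) K} (hb : b.1 = 0) :
    (adelicTrace K (a * b)).1 = 0 := by
  refine Finset.sum_eq_zero fun v _ => ?_
  have h : (a * b).1 v = 0 := by
    change a.1 v * b.1 v = 0
    rw [hb]
    exact mul_zero _
  rw [h, infiniteTrace]
  exact map_zero _

theorem adelicPairing_algebraMap_eq_finprod (k : K) {b : AdeleRing (𝓞 K) K} (hb : b.1 = 0) :
    adelicPairing K (algebraMap K (AdeleRing (𝓞 K) K) k) b =
      ∏ᶠ p : Nat.Primes, localPairing p.1 k b := by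
  have hreal : realChar 0 = 1 := by simp [realChar]
  rw [adelicPairing, adelicChar, adelicTrace_fst_eq_zero _ hb, hreal, one_mul]
  refine finprod_congr fun p => congrArg (padicChar p.1) ?_
  rw [trace_localProduct_apply]
  exact finsum_eq_sum_of_fintype _

section LocalPairing

variable {p : ℕ} [Fact p.Prime]

theorem trace_algebraMap_natCast_mul (N : ℕ) (k : K) (d : LocalProduct K p) :
    Algebra.trace ℚ_[p] (LocalProduct K p) (algebraMap K (LocalProduct K p) (N * k) * d) =
      N * Algebra.trace ℚ_[p] (LocalProduct K p) (algebraMap K (LocalProduct K p) k * d) := by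
  rw [map_mul (algebraMap _ _), map_natCast, mul_assoc, ← nsmul_eq_mul, map_nsmul, nsmul_eq_mul]

theorem localPairing_add_left (k l : K) (b : AdeleRing (𝓞 K) K) :
    localPairing p (k + l) b = localPairing p k b * localPairing p l b := by
  rw [localPairing, map_add, add_mul, map_add, padicChar_add]
  rfl

theorem localPairing_add_right (k : K) (b c : AdeleRing (𝓞 K) K) :
    localPairing p k (b + c) = localPairing p k b * localPairing p k c := by
  rw [localPairing, localPairing, localPairing, ← padicChar_add, ← map_add, ← mul_add]
  rfl

theorem continuous_localPairing (k : K) :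
    Continuous fun b : AdeleRing (𝓞 K) K => localPairing p k b :=
  (continuous_padicChar p).comp <|
    (Algebra.trace ℚ_[p] (LocalProduct K p)).continuous_of_finiteDimensional.comp <|
      continuous_const.mul (continuous_pi fun w => continuous_adele_apply w.1)

variable {b : AdeleRing (𝓞 K) K} (hb : b ∈ adelicInverseDifferent K)
include hb

theorem trace_algebraMap_mul_localComponent_mem (x : 𝓞 K) :
    Algebra.trace ℚ_[p] (LocalProduct K p)
      (algebraMap K (LocalProduct K p) x * localComponent p b) ∈ PadicInt.subring p :=
  (forall_mem_localInverseDifferent_iff _).1 (fun w => hb.2 w.1) _ fun w =>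
    algebraMap_mem_adicCompletionIntegers w.1 x

theorem localPairing_eq_one_of_not_dvd {N : ℕ} (hp : ¬ p ∣ N) {k : K}
    (hN : (N : K) * k ∈ (algebraMap (𝓞 K) K).range) : localPairing p k b = 1 := by
  obtain ⟨x, hx : (x : K) = N * k⟩ := hN
  have hmem := trace_algebraMap_mul_localComponent_mem (p := p) hb x
  have hnorm : ‖(N : ℚ_[p])‖ = 1 := Padic.norm_natCast_eq_one_iff.2
    (((Fact.out : p.Prime).coprime_iff_not_dvd).2 hp)
  rw [hx, trace_algebraMap_natCast_mul] at hmem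
  refine padicChar_eq_one_iff.2 ?_
  change ‖_‖ ≤ 1 at hmem ⊢
  rwa [norm_mul, hnorm, one_mul] at hmem

end LocalPairing

theorem exists_finset_localPairing_eq_one (k : K) :
    ∃ S : Finset Nat.Primes, ∀ b ∈ adelicInverseDifferent K,
      (Function.mulSupport fun p : Nat.Primes => localPairing p.1 k b) ⊆ S := by
  obtain ⟨N, hN0, hN⟩ := exists_natCast_mul_mem_integers {k}
  have hfinite : {p : Nat.Primes | p.1 ∣ N}.Finite :=
    (N.primeFactors.finite_toSet.preimage Subtype.val_injective.injOn).subset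
      fun p hp => Nat.mem_primeFactors.2 ⟨p.2, hp, hN0⟩
  refine ⟨hfinite.toFinset, fun b hb p hp => ?_⟩
  rw [hfinite.coe_toFinset]
  by_contra hpN
  exact hp (localPairing_eq_one_of_not_dvd hb hpN (hN k (Finset.mem_singleton_self k)))

/-! ### The canonical pairing of `K` with the adelic inverse different -/

theorem continuous_adelicPairing_algebraMap (k : K) :
    Continuous fun b : adelicInverseDifferent K =>
      adelicPairing K (algebraMap K (AdeleRing (𝓞 K) K) k) b := by
  obtain ⟨S, hS⟩ := exists_finset_localPairing_eq_one k
  have hprod (b : adelicInverseDifferent K) :=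
    (adelicPairing_algebraMap_eq_finprod k b.2.1).trans
      (finprod_eq_prod_of_mulSupport_subset _ (hS b b.2))
  simp only [hprod]
  exact continuous_finsetProd _ fun p _ => (continuous_localPairing k).comp continuous_subtype_val

section Pairing

variable {b : AdeleRing (𝓞 K) K} (hb : b ∈ adelicInverseDifferent K)
include hb

theorem hasFiniteMulSupport_localPairing (k : K) :
    Function.HasFiniteMulSupport fun p : Nat.Primes => localPairing p.1 k b := by
  obtain ⟨S, hS⟩ := exists_finset_localPairing_eq_one k
  exact S.finite_toSet.subset (hS b hb)

theorem adelicPairing_algebraMap_add_left (k l : K) :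
    adelicPairing K (algebraMap K (AdeleRing (𝓞 K) K) (k + l)) b =
      adelicPairing K (algebraMap K (AdeleRing (𝓞 K) K) k) b *
        adelicPairing K (algebraMap K (AdeleRing (𝓞 K) K) l) b := by
  simp only [adelicPairing_algebraMap_eq_finprod _ hb.1, localPairing_add_left]
  exact finprod_mul_distrib (hasFiniteMulSupport_localPairing hb k)
    (hasFiniteMulSupport_localPairing hb l)

theorem adelicPairing_algebraMap_add_right (k : K) {c : AdeleRing (𝓞 K) K}
    (hc : c ∈ adelicInverseDifferent K) :
    adelicPairing K (algebraMap K (AdeleRing (𝓞 K) K) k) (b + c) =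
      adelicPairing K (algebraMap K (AdeleRing (𝓞 K) K) k) b *
        adelicPairing K (algebraMap K (AdeleRing (𝓞 K) K) k) c := by
  simp only [adelicPairing_algebraMap_eq_finprod _ hb.1, adelicPairing_algebraMap_eq_finprod _ hc.1,
    adelicPairing_algebraMap_eq_finprod _ (add_mem hb hc).1, localPairing_add_right]
  exact finprod_mul_distrib (hasFiniteMulSupport_localPairing hb k)
    (hasFiniteMulSupport_localPairing hc k)

theorem adelicPairing_integer (x : 𝓞 K) :
    adelicPairing K (algebraMap K (AdeleRing (𝓞 K) K) x) b = 1 := by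
  rw [adelicPairing_algebraMap_eq_finprod _ hb.1]
  exact finprod_eq_one_of_forall_eq_one fun p =>
    padicChar_eq_one_iff.2 (trace_algebraMap_mul_localComponent_mem hb x)

theorem adelicPairing_div_prime_pow {k : K} (hk : k ∈ (algebraMap (𝓞 K) K).range)
    (p : Nat.Primes) (n : ℕ) :
    adelicPairing K (algebraMap K (AdeleRing (𝓞 K) K) (k / (p.1 : K) ^ n)) b =
      localPairing p.1 (k / (p.1 : K) ^ n) b := by
  have hp : (p.1 : K) ^ n ≠ 0 := pow_ne_zero n (Nat.cast_ne_zero.2 p.2.ne_zero)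
  rw [adelicPairing_algebraMap_eq_finprod _ hb.1]
  refine finprod_eq_single _ p fun l hl => localPairing_eq_one_of_not_dvd hb (N := p.1 ^ n) ?_ ?_
  · exact fun h => hl (Subtype.ext ((Nat.prime_dvd_prime_iff_eq l.2 p.2).1 (l.2.dvd_of_dvd_pow h)))
  · rwa [Nat.cast_pow, mul_div_cancel₀ _ hp]

theorem eq_zero_of_forall_adelicPairing_eq_one
    (h : ∀ k : K, adelicPairing K (algebraMap K (AdeleRing (𝓞 K) K) k) b = 1) : b = 0 := by
  suffices hlocal : ∀ p : Nat.Primes, localComponent p.1 b = 0 by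
    refine Prod.ext hb.1 (FiniteAdeleRing.ext K fun v => ?_)
    obtain ⟨p, hv⟩ := exists_prime_mem_asIdeal v
    exact congrFun (hlocal p) ⟨v, hv⟩
  intro p
  rw [← sum_trace_smul_dualIntegralBasis (localComponent p.1 b)]
  refine Finset.sum_eq_zero fun i _ => ?_
  refine (congrArg (· • _) (padic_eq_zero_of_forall_div_pow_mem fun n => ?_)).trans (zero_smul _ _)
  have hp : (p.1 : K) ^ n ≠ 0 := pow_ne_zero n (Nat.cast_ne_zero.2 p.2.ne_zero)
  have hp' : (p.1 : ℚ_[p.1]) ^ n ≠ 0 := pow_ne_zero n (Nat.cast_ne_zero.2 p.2.ne_zero)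
  have hn := h (integralBasis K i / (p.1 : K) ^ n)
  rw [adelicPairing_div_prime_pow hb ⟨_, (integralBasis_apply K i).symm⟩, localPairing,
    padicChar_eq_one_iff] at hn
  conv in algebraMap K _ _ => rw [← mul_div_cancel₀ (integralBasis K i) hp, ← Nat.cast_pow]
  rwa [trace_algebraMap_natCast_mul, Nat.cast_pow, Nat.cast_pow, mul_div_cancel_left₀ _ hp']

end Pairing

theorem exists_localComponent_eq (p : Nat.Primes) {d : LocalProduct K p.1}
    (hd : ∀ w, d w ∈ localInverseDifferent w.1) :
    ∃ b ∈ adelicInverseDifferent K, localComponent p.1 b = d ∧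
      ∀ l : Nat.Primes, l ≠ p → localComponent l.1 b = 0 := by
  classical
  obtain ⟨ι, hι⟩ := exists_inverseDifferent_continuousAddEquiv K
  let e (v : HeightOneSpectrum (𝓞 K)) : localInverseDifferent v :=
    if hv : (p.1 : 𝓞 K) ∈ v.asIdeal then ⟨d ⟨v, hv⟩, hd ⟨v, hv⟩⟩ else 0
  refine ⟨ι e, (ι e).2, funext fun w => ?_, fun l hl => funext fun w => ?_⟩
  · refine ((hι e).2 w.1).trans ?_
    simp only [e, dif_pos w.2]
  · have hw : (p.1 : 𝓞 K) ∉ w.1.asIdeal := fun hw => hl (eq_of_prime_mem_asIdeal w.2 hw)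
    refine ((hι e).2 w.1).trans ?_
    simp only [e, dif_neg hw]
    rfl

theorem exists_prime_repr_integralBasis_notMem {k : K} (hk : k ∉ (algebraMap (𝓞 K) K).range) :
    ∃ (i : BasisIndex K) (p : Nat.Primes),
      ((integralBasis K).repr k i : ℚ_[p.1]) ∉ PadicInt.subring p.1 := by
  by_contra! h
  choose m hm using fun i => exists_eq_intCast_iff_forall_mem_padicInt.2 (h i)
  refine hk ?_
  rw [← (integralBasis K).sum_repr k]
  refine sum_mem fun i _ => ?_
  rw [hm i, Int.cast_smul_eq_zsmul, integralBasis_apply]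
  exact zsmul_mem (RingHom.mem_range_self _ _) _

theorem mem_range_of_forall_adelicPairing_eq_one {k : K}
    (h : ∀ b ∈ adelicInverseDifferent K,
      adelicPairing K (algebraMap K (AdeleRing (𝓞 K) K) k) b = 1) :
    k ∈ (algebraMap (𝓞 K) K).range := by
  by_contra hk
  obtain ⟨i, p, hp⟩ := exists_prime_repr_integralBasis_notMem hk
  obtain ⟨b, hb, hbp, hbl⟩ := exists_localComponent_eq p (algebraMap_dualIntegralBasis_mem i)
  have hpairing := h b hb
  rw [adelicPairing_algebraMap_eq_finprod _ hb.1, finprod_eq_single _ p] at hpairing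
  · rw [localPairing, padicChar_eq_one_iff, hbp] at hpairing
    refine hp ?_
    rw [← trace_mul_dualIntegralBasis, ← trace_localProduct_algebraMap, map_mul]
    exact hpairing
  · intro l hl
    rw [localPairing, hbl l hl, mul_zero, map_zero]
    exact padicChar_eq_one_iff.2 (zero_mem _)

/-! ### The duality between `K / 𝓞` and the adelic inverse different -/

theorem toFieldModIntegers_eq_zero_iff {F : Type*} [Field F] {k : F} :
    toFieldModIntegers k = 0 ↔ k ∈ (algebraMap (𝓞 F) F).range :=
  QuotientAddGroup.eq_zero_iff k

theorem exists_ofAdd_toFieldModIntegers_eq {F : Type*} [Field F]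
    (a : Multiplicative (FieldModIntegers F)) :
    ∃ k, Multiplicative.ofAdd (toFieldModIntegers k) = a :=
  QuotientAddGroup.mk_surjective a.toAdd

variable (K) in
theorem isMulTorsion_fieldModIntegers : IsMulTorsion (Multiplicative (FieldModIntegers K)) := by
  intro a
  obtain ⟨k, rfl⟩ := exists_ofAdd_toFieldModIntegers_eq a
  obtain ⟨N, hN0, hN⟩ := exists_natCast_mul_mem_integers {k}
  have hNk : toFieldModIntegers (N • k) = 0 := by
    rw [toFieldModIntegers_eq_zero_iff, nsmul_eq_mul]
    exact hN k (Finset.mem_singleton_self k)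
  exact isOfFinOrder_iff_pow_eq_one.2
    ⟨N, Nat.pos_of_ne_zero hN0, congrArg Multiplicative.ofAdd hNk⟩

/-- The character `k + 𝓞 ↦ ⟨k, b⟩` of `K / 𝓞` defined by an element `b` of the adelic inverse
different. -/
def pairingChar (b : adelicInverseDifferent K) :
    PontryaginDual (Multiplicative (FieldModIntegers K)) :=
  let pairing : K →+ Additive Circle := AddMonoidHom.mk'
    (fun k => Additive.ofMul (adelicPairing K (algebraMap K (AdeleRing (𝓞 K) K) k) b))
    (adelicPairing_algebraMap_add_left b.2)
  let lift : FieldModIntegers K →+ Additive Circle :=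
    QuotientAddGroup.lift (integersAddSubgroup K) pairing (by
      rintro _ ⟨x, rfl⟩
      exact adelicPairing_integer b.2 x)
  (⟨AddMonoidHom.toMultiplicativeLeft lift, continuous_of_discreteTopology⟩ :
    Multiplicative (FieldModIntegers K) →ₜ* Circle)

theorem pairingChar_apply (b : adelicInverseDifferent K) (k : K) :
    pairingChar b (Multiplicative.ofAdd (toFieldModIntegers k)) =
      adelicPairing K (algebraMap K (AdeleRing (𝓞 K) K) k) b := rfl

variable (K) in
/-- The homomorphism from the adelic inverse different to the dual of `K / 𝓞` induced by the
canonical pairing. -/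
def pairingHom : Multiplicative (adelicInverseDifferent K) →*
    PontryaginDual (Multiplicative (FieldModIntegers K)) :=
  MonoidHom.mk' (fun b => pairingChar b.toAdd) fun b c => PontryaginDual.ext fun a => by
    obtain ⟨k, rfl⟩ := exists_ofAdd_toFieldModIntegers_eq a
    exact adelicPairing_algebraMap_add_right b.toAdd.2 k c.toAdd.2

theorem pairingHom_injective : Function.Injective (pairingHom K) := by
  refine (injective_iff_map_eq_one _).2 fun b hb => ?_
  refine congrArg Multiplicative.ofAdd (Subtype.ext
    (eq_zero_of_forall_adelicPairing_eq_one b.toAdd.2 fun k => ?_))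
  exact DFunLike.congr_fun hb (Multiplicative.ofAdd (toFieldModIntegers k))

theorem continuous_pairingHom_apply (a : Multiplicative (FieldModIntegers K)) :
    Continuous fun b => pairingHom K b a := by
  obtain ⟨k, rfl⟩ := exists_ofAdd_toFieldModIntegers_eq a
  exact (continuous_adelicPairing_algebraMap k).comp continuous_toAdd

theorem eq_one_of_forall_pairingHom_eq_one {a : Multiplicative (FieldModIntegers K)}
    (ha : ∀ b, pairingHom K b a = 1) : a = 1 := by
  obtain ⟨k, rfl⟩ := exists_ofAdd_toFieldModIntegers_eq a
  refine congrArg Multiplicative.ofAdd (toFieldModIntegers_eq_zero_iff.2 ?_)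
  exact mem_range_of_forall_adelicPairing_eq_one fun b hb => ha (Multiplicative.ofAdd ⟨b, hb⟩)

variable (K) in
/-- The duality between the adelic inverse different and `K / 𝓞` given by the canonical
pairing. -/
def inverseDifferentEquivDual : Multiplicative (adelicInverseDifferent K) ≃ₜ*
    PontryaginDual (Multiplicative (FieldModIntegers K)) :=
  equivPontryaginDual (isMulTorsion_fieldModIntegers K) (pairingHom K) continuous_pairingHom_apply
    pairingHom_injective fun _ => eq_one_of_forall_pairingHom_eq_one

theorem inverseDifferentEquivDual_apply (b : adelicInverseDifferent K) (k : K) :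
    inverseDifferentEquivDual K (Multiplicative.ofAdd b)
        (Multiplicative.ofAdd (toFieldModIntegers k)) =
      adelicPairing K (algebraMap K (AdeleRing (𝓞 K) K) k) b := by
  rw [inverseDifferentEquivDual, equivPontryaginDual_apply]
  exact pairingChar_apply b k

end AdelicDuality

end

theorem mainTheorem11 (K : Type*) [Field K] [NumberField K] :
    (∃ ι : (∀ v : HeightOneSpectrum (𝓞 K), AdelicDuality.localInverseDifferent v) ≃ₜ+
        AdelicDuality.adelicInverseDifferent K,
      ∀ d, (ι d : AdeleRing (𝓞 K) K).1 = 0 ∧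
        ∀ v : HeightOneSpectrum (𝓞 K), (ι d : AdeleRing (𝓞 K) K).2 v = d v) ∧
    ∃ Φ : PontryaginDual (Multiplicative (AdelicDuality.FieldModIntegers K)) ≃ₜ*
        Multiplicative (AdelicDuality.adelicInverseDifferent K),
      ∀ (χ : PontryaginDual (Multiplicative (AdelicDuality.FieldModIntegers K))) (k : K),
        χ (Multiplicative.ofAdd (AdelicDuality.toFieldModIntegers k)) =
          AdelicDuality.adelicPairing K (algebraMap K (AdeleRing (𝓞 K) K) k)
            ((Φ χ).toAdd : AdeleRing (𝓞 K) K) := by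
  refine ⟨AdelicDuality.exists_inverseDifferent_continuousAddEquiv K,
    (AdelicDuality.inverseDifferentEquivDual K).symm, fun χ k => ?_⟩
  obtain ⟨b, rfl⟩ := (AdelicDuality.inverseDifferentEquivDual K).surjective χ
  rw [ContinuousMulEquiv.symm_apply_apply]
  exact AdelicDuality.inverseDifferentEquivDual_apply b.toAdd k
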